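/- Let $\mathbb{K}$ be a field of characteristic zero. A line arrangement $\mathcal{A}$ in $\mathbf{P}^2_{\mathbb{K}}$ is a finite set of lines with no point common to all of them; equivalently, a finite set of two-dimensional linear subspaces of $\mathbb{K}^3$ whose intersection is $\{0\}$. Let $L_2(\mathcal{A})$ be the set of points of $\mathbf{P}^2_{\mathbb{K}}$ that are intersections of lines of $\mathcal{A}$. For $p\in L_2(\mathcal{A})$ put $\mathcal{A}_p:=\{H\in\mathcal{A}\mid p\in H\}$ and $\mu(p):=|\mathcal{A}_p|-1$, and for $H\in\mathcal{A}$ let $n_2(H):=|\{q\in L_2(\mathcal{A})\mid \mu(q)=1,\ q\in H\}|$ be the number of double points on $H$. A point $p\in L_2(\mathcal{A})$ is called modular if for all distinct $H,L\in\mathcal{A}\setminus\mathcal{A}_p$ there is a unique $K\in\mathcal{A}_p$ with $H\cap L\subset K$, and $\mathcal{A}$ is called supersolvable if it has a modular point. Theorem. There is no supersolvable line arrangement $\mathcal{A}$ in $\mathbf{P}^2_{\mathbb{K}}$ with a modular point $p$ with $\mu(p)\ge 2$ such that $n_2(H)=0$ for some $H\in\mathcal{A}\setminus\mathcal{A}_p$.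 -/

import Mathlib

/-- A line arrangement in the projective plane over `K`, given as an arrangement of linear planes
in `V = K³`: a finite set of two-dimensional subspaces of `V` (the lines of the projective plane)
whose common intersection is the origin (the arrangement is essential). -/
structure LineArrangement (K : Type*) [Field K] where
  lines : Set (Submodule K (Fin 3 → K))
  finite_lines : lines.Finite
  finrank_eq_two : ∀ H ∈ lines, Module.finrank K H = 2
  essential : sInf lines = ⊥

namespace LineArrangement

/-- The intersection lattice `L(A)`: all intersections of subsets of the arrangement, the empty
intersection being the whole space. -/
def intersectionLattice {K : Type*} [Field K] (A : LineArrangement K) :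
    Set (Submodule K (Fin 3 → K)) :=
  {X | ∃ B : Set (Submodule K (Fin 3 → K)), B ⊆ A.lines ∧ X = sInf B}

/-- The set `L₂(A)` of the points of the arrangement: the elements of the intersection lattice of
codimension two in `K³`, that is, of dimension one. -/
def points {K : Type*} [Field K] (A : LineArrangement K) : Set (Submodule K (Fin 3 → K)) :=
  {X | X ∈ A.intersectionLattice ∧ Module.finrank K X = 1}

/-- The lines `A_p` of the arrangement that pass through `p`. -/
def linesThrough {K : Type*} [Field K] (A : LineArrangement K)
    (p : Submodule K (Fin 3 → K)) : Set (Submodule K (Fin 3 → K)) :=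
  {H | H ∈ A.lines ∧ p ≤ H}

/-- The Möbius function `μ(p) = |A_p| - 1` at a point `p`. -/
noncomputable def mu {K : Type*} [Field K] (A : LineArrangement K)
    (p : Submodule K (Fin 3 → K)) : ℤ :=
  ((A.linesThrough p).ncard : ℤ) - 1

/-- The double points of the arrangement that lie on `H`. -/
def doublePointsOn {K : Type*} [Field K] (A : LineArrangement K)
    (H : Submodule K (Fin 3 → K)) : Set (Submodule K (Fin 3 → K)) :=
  {q | q ∈ A.points ∧ A.mu q = 1 ∧ q ≤ H}

/-- The number `n₂(H)` of double points of the arrangement on `H`. -/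
noncomputable def n2 {K : Type*} [Field K] (A : LineArrangement K)
    (H : Submodule K (Fin 3 → K)) : ℕ :=
  (A.doublePointsOn H).ncard

/-- The set counted by `n2` is finite. -/
theorem finite_doublePointsOn {K : Type*} [Field K] (A : LineArrangement K)
    (H : Submodule K (Fin 3 → K)) : (A.doublePointsOn H).Finite := by
  refine (A.finite_lines.finite_subsets.image sInf).subset ?_
  rintro q ⟨⟨⟨B, hB, rfl⟩, -⟩, -⟩
  exact ⟨B, hB, rfl⟩

/-- `p` is a modular point: a point of the arrangement such that any two distinct lines of the
arrangement not through `p` meet on a unique line of the arrangement through `p`. -/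
def IsModularPoint {K : Type*} [Field K] (A : LineArrangement K)
    (p : Submodule K (Fin 3 → K)) : Prop :=
  p ∈ A.points ∧
    ∀ H ∈ A.lines \ A.linesThrough p, ∀ L ∈ A.lines \ A.linesThrough p, H ≠ L →
      ∃! M : Submodule K (Fin 3 → K), M ∈ A.linesThrough p ∧ H ⊓ L ≤ M

/-- The arrangement is supersolvable: it has a modular point. -/
def IsSupersolvable {K : Type*} [Field K] (A : LineArrangement K) : Prop :=
  ∃ p, A.IsModularPoint p

end LineArrangement

/-! In coordinates where `H` is the zero function and `p` the vertical direction, each line off `p`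
becomes an affine function `f` of `X`, and each line through `p` a value `a`; let `D` be the set of
these values, `d` its size, `Q = ∏ (X - a)`. Modularity says that any two of the functions agree at
some `a ∈ D`; having no double point on `H` says that each `a ∈ D` is a root of some nonzero `f`.
These two conditions are incompatible when `d ≥ 2`.

Modularity yields `G(X, Y)` of total degree at most `d - 1` with `G(X, f) = d f' Q - f Q'` for every
`f` (`exists_interpolation`). As `G(X, 0) = 0`, divide by `Y`: a nonzero `f` with root `a` forces
the coefficient of `Y` in `G` to equal `(d - 1) Q'(a)` at `a`. If every `a ∈ D` is such a root, this
coefficient, of degree at most `d - 2`, equals `(d - 1) Q'`, whose leading coefficient `d (d - 1)`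
is nonzero in characteristic zero. -/

/-! ### Total degree of bivariate polynomials. -/

open Polynomial in
/-- A polynomial in `Y` over `R[X]` has total degree at most `d`. -/
def BivariateTotalDegreeLE {R : Type*} [CommRing R] (d : ℕ) (G : R[X][X]) : Prop :=
  ∀ i j, d < i + j → (G.coeff i).coeff j = 0

namespace BivariateTotalDegreeLE

open Polynomial

variable {R : Type*} [CommRing R]

theorem mono {d e : ℕ} {G : R[X][X]} (hG : BivariateTotalDegreeLE d G) (h : d ≤ e) :
    BivariateTotalDegreeLE e G := fun i j hij => hG i j (by omega)

theorem add {d : ℕ} {G G' : R[X][X]} (hG : BivariateTotalDegreeLE d G)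
    (hG' : BivariateTotalDegreeLE d G') : BivariateTotalDegreeLE d (G + G') := fun i j hij => by
  rw [coeff_add, coeff_add, hG i j hij, hG' i j hij, add_zero]

theorem mul {d e : ℕ} {G G' : R[X][X]} (hG : BivariateTotalDegreeLE d G)
    (hG' : BivariateTotalDegreeLE e G') : BivariateTotalDegreeLE (d + e) (G * G') := by
  intro i j hij
  rw [coeff_mul, finsetSum_coeff]
  refine Finset.sum_eq_zero fun a ha => ?_
  rw [coeff_mul]
  refine Finset.sum_eq_zero fun b hb => ?_
  rw [Finset.HasAntidiagonal.mem_antidiagonal] at ha hb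
  rcases lt_or_ge d (a.1 + b.1) with h | h
  · rw [hG _ _ h, zero_mul]
  · rw [hG' a.2 b.2 (by omega), mul_zero]

theorem C_of_natDegree_le {d : ℕ} {c : R[X]} (h : c.natDegree ≤ d) :
    BivariateTotalDegreeLE d (C c) := by
  intro i j hij
  rw [coeff_C]
  split_ifs with hi
  · exact coeff_eq_zero_of_natDegree_lt (by omega)
  · exact coeff_zero _

theorem X_sub_C {f : R[X]} (h : f.natDegree ≤ 1) :
    BivariateTotalDegreeLE 1 (X - C f) := by
  intro i j hij
  rw [coeff_sub, coeff_sub, C_of_natDegree_le h i j hij, sub_zero, coeff_X]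
  split_ifs with hi
  · rw [coeff_one, if_neg (by omega)]
  · exact coeff_zero _

theorem prod_X_sub_C (F : Finset R[X]) (hF : ∀ f ∈ F, f.natDegree ≤ 1) :
    BivariateTotalDegreeLE F.card (∏ f ∈ F, (X - C f)) := by
  classical
  induction F using Finset.induction_on with
  | empty =>
    rw [Finset.prod_empty, ← C_1]
    exact C_of_natDegree_le (by simp)
  | insert f F hf ih =>
    rw [Finset.prod_insert hf, Finset.card_insert_of_notMem hf, add_comm]
    exact (X_sub_C (hF f (Finset.mem_insert_self f F))).mul
      (ih fun g hg => hF g (Finset.mem_insert_of_mem hg))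

theorem natDegree_eval_le {d : ℕ} {G : R[X][X]} (hG : BivariateTotalDegreeLE d G) {f : R[X]}
    (hf : f.natDegree ≤ 1) : (G.eval f).natDegree ≤ d := by
  rw [eval_eq_sum_range]
  refine natDegree_sum_le_of_forall_le _ _ fun i _ => ?_
  by_cases h0 : G.coeff i = 0
  · rw [h0, zero_mul, natDegree_zero]; exact Nat.zero_le _
  have hi : i + (G.coeff i).natDegree ≤ d := by
    by_contra h
    exact h0 (leadingCoeff_eq_zero.1 (hG i _ (by omega)))
  have h1 : (f ^ i).natDegree ≤ i * 1 := natDegree_pow_le_of_le i hf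
  have h2 := natDegree_mul_le (p := G.coeff i) (q := f ^ i)
  omega

end BivariateTotalDegreeLE

/-! ### Interpolation along affine functions. -/

namespace AffineInterpolation

open Polynomial

variable {K : Type*} [Field K]

/-- The values that the interpolating polynomial has to take on the lines `y = f(x)`. -/
noncomputable def target (D : Finset K) (f : K[X]) : K[X] :=
  C (D.card : K) * derivative f * (∏ a ∈ D, (X - C a)) - f * derivative (∏ a ∈ D, (X - C a))

theorem natDegree_prod_X_sub_C (D : Finset K) : (∏ a ∈ D, (X - C a)).natDegree = D.card :=
  natDegree_finsetProd_X_sub_C_eq_card D fun a => a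

theorem coeff_card_prod_X_sub_C (D : Finset K) : (∏ a ∈ D, (X - C a)).coeff D.card = 1 := by
  have h : (∏ a ∈ D, (X - C a)).Monic := monic_prod_of_monic _ _ fun a _ =>
    monic_X_sub_C a
  simpa only [natDegree_prod_X_sub_C] using h.coeff_natDegree

theorem coeff_derivative_prod_X_sub_C {D : Finset K} (hD : D.Nonempty) :
    (derivative (∏ a ∈ D, (X - C a))).coeff (D.card - 1) = (D.card : K) := by
  have hpos := hD.card_pos
  have h1 := coeff_card_prod_X_sub_C D
  rw [coeff_derivative, Nat.sub_add_cancel hpos, h1, one_mul, ← Nat.cast_succ,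
    Nat.succ_eq_add_one, Nat.sub_add_cancel hpos]

theorem natDegree_derivative_prod_X_sub_C_le (D : Finset K) :
    (derivative (∏ a ∈ D, (X - C a))).natDegree ≤ D.card - 1 := by
  have := natDegree_derivative_le (∏ a ∈ D, (X - C a))
  rwa [natDegree_prod_X_sub_C] at this

/-- For `f = αX + β` both terms have coefficient `dα` in degree `d`, so they cancel. The factor `d`
in `target` is there for this. -/
theorem natDegree_target_le {D : Finset K} (hD : D.Nonempty) {f : K[X]} (hf : f.natDegree ≤ 1) :
    (target D f).natDegree ≤ D.card - 1 := by
  have hpos := hD.card_pos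
  have hQ : (∏ a ∈ D, (X - C a)).natDegree = D.card := natDegree_prod_X_sub_C D
  have hQ' := natDegree_derivative_prod_X_sub_C_le D
  have hc := coeff_derivative_prod_X_sub_C hD
  have h1 := coeff_card_prod_X_sub_C D
  obtain ⟨α, β, rfl⟩ : ∃ α β : K, f = C α * X + C β :=
    ⟨_, _, eq_X_add_C_of_natDegree_le_one hf⟩
  unfold target
  generalize (∏ a ∈ D, (X - C a) : K[X]) = Q at *
  have hd : derivative (C α * X + C β) = (C α : K[X]) := by simp
  rw [hd]
  refine natDegree_le_pred ?_ ?_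
  · refine (natDegree_sub_le_of_le (m := D.card) (n := D.card) ?_ ?_).trans (max_self _).le
    · rw [← C_mul]
      exact (natDegree_C_mul_le _ _).trans hQ.le
    · refine natDegree_mul_le.trans ?_
      omega
  · have h2 : (derivative Q).coeff D.card = 0 := coeff_eq_zero_of_natDegree_lt (by omega)
    have h3 : (X * derivative Q).coeff D.card = (D.card : K) := by
      obtain ⟨n, hn⟩ := Nat.exists_eq_add_of_lt hpos
      rw [← hc, hn]
      simp
    rw [coeff_sub, ← C_mul, coeff_C_mul, h1, add_mul, coeff_add, mul_assoc (C α), coeff_C_mul, h3,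
      coeff_C_mul, h2]
    ring

/-- If `G` takes the prescribed values on finitely many lines through the point of `y = f(x)` over
`a`, then the error of `G` on `y = f(x)` is divisible by the product of the differences. -/
theorem prod_sub_dvd_of_concurrent {D : Finset K} {a : K} (ha : a ∈ D) {f : K[X]}
    (F : Finset K[X]) (hF : ∀ g ∈ F, ∃ c, f - g = C c * (X - C a)) (G : K[X][X])
    (hG : ∀ g ∈ F, G.eval g = target D g) :
    ∏ g ∈ F, (f - g) ∣ target D f - G.eval f := by
  classical
  set Q₁ := ∏ b ∈ D.erase a, (X - C b) with hQ₁
  have hQ : (∏ b ∈ D, (X - C b)) = (X - C a) * Q₁ := (Finset.mul_prod_erase D _ ha).symm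
  -- For `g = f - c(X - a)`, `g' Q = f' Q + Q₁ (g - f)`: on this pencil the target depends on `g`
  -- polynomially, without derivatives, and `T` is that polynomial minus `G`.
  set T : K[X][X] := C (C (D.card : K) * derivative f * ((X - C a) * Q₁))
    + C (C (D.card : K) * Q₁) * (X - C f) - X * C (derivative ((X - C a) * Q₁)) - G with hT
  have hroot : ∀ g ∈ F, T.IsRoot g := by
    intro g hg
    obtain ⟨c, hc⟩ := hF g hg
    have hg' : g = f - C c * (X - C a) := by rw [← hc]; ring
    have hder : derivative g = derivative f - C c := by
      rw [hg']; simp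
    rw [IsRoot.def, hT]
    simp only [eval_sub, eval_add, eval_mul, eval_C, eval_X]
    rw [hG g hg, target, hQ, hder]
    rw [show g - f = - (C c * (X - C a)) by rw [← hc]; ring]
    ring
  have hdvd : ∏ g ∈ F, (X - C g) ∣ T := by
    by_cases hT0 : T = 0
    · rw [hT0]; exact dvd_zero _
    refine (Multiset.prod_X_sub_C_dvd_iff_le_roots hT0 F.val).2
      ((Multiset.le_iff_subset F.nodup).2 fun g hg => (mem_roots hT0).2 (hroot g hg))
  obtain ⟨S, hS⟩ := hdvd
  have hev : T.eval f = target D f - G.eval f := by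
    rw [hT, target, hQ]
    simp only [eval_sub, eval_add, eval_mul, eval_C, eval_X]
    ring
  rw [← hev, hS, eval_mul, eval_prod]
  simp only [eval_sub, eval_X, eval_C]
  exact dvd_mul_right _ _

/-- Group the `g` by the point `a` where they meet `f`; the products for different `a` are coprime.
-/
theorem prod_sub_dvd {D : Finset K} {f : K[X]} (F : Finset K[X]) (hf : f ∉ F)
    (hF : ∀ g ∈ F, ∃ a ∈ D, ∃ c, f - g = C c * (X - C a)) (G : K[X][X])
    (hG : ∀ g ∈ F, G.eval g = target D g) :
    ∏ g ∈ F, (f - g) ∣ target D f - G.eval f := by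
  classical
  choose! s hs hc using hF
  rw [← Finset.prod_fiberwise_of_maps_to hs]
  refine Finset.prod_dvd_of_coprime ?_ fun a ha => ?_
  · intro a _ b _ hab
    refine IsCoprime.prod_left fun g hg => IsCoprime.prod_right fun h hh => ?_
    obtain ⟨hg, hga⟩ := Finset.mem_filter.1 hg
    obtain ⟨hh, hhb⟩ := Finset.mem_filter.1 hh
    have hunit : ∀ g ∈ F, ∃ c, IsUnit (C c) ∧ f - g = C c * (X - C (s g)) := by
      intro g hg
      obtain ⟨c, hc⟩ := hc g hg
      refine ⟨c, isUnit_C.2 (IsUnit.mk0 c ?_), hc⟩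
      rintro rfl
      exact hf ((sub_eq_zero.1 (by rw [hc]; simp) : f = g) ▸ hg)
    obtain ⟨c, hcu, hc⟩ := hunit g hg
    obtain ⟨d, hdu, hd⟩ := hunit h hh
    rw [hc, hd, hga, hhb, isCoprime_mul_unit_left_left hcu, isCoprime_mul_unit_left_right hdu]
    exact isCoprime_X_sub_C_of_isUnit_sub (sub_ne_zero.2 hab).isUnit
  · refine prod_sub_dvd_of_concurrent ha _ ?_ G fun g hg => hG g (Finset.mem_filter.1 hg).1
    intro g hg
    obtain ⟨hg, hga⟩ := Finset.mem_filter.1 hg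
    exact hga ▸ hc g hg

/-- Newton interpolation: the error at a new `f` is divisible by `∏ (f - g)`, so a multiple of `∏ (Y
- g)` corrects it. The error has degree at most `d - 1`, which bounds the correction and makes it
zero once there are `d` earlier functions. -/
theorem exists_interpolation {D : Finset K} (hD : D.Nonempty) (F : Finset K[X])
    (hdeg : ∀ f ∈ F, f.natDegree ≤ 1)
    (hF : ∀ f ∈ F, ∀ g ∈ F, f ≠ g → ∃ a ∈ D, ∃ c, f - g = C c * (X - C a)) :
    ∃ G : K[X][X], BivariateTotalDegreeLE (D.card - 1) G ∧ ∀ f ∈ F, G.eval f = target D f := by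
  classical
  induction F using Finset.induction_on with
  | empty => exact ⟨0, fun i j _ => by simp, by simp⟩
  | insert f F hf ih =>
    obtain ⟨G, hGd, hG⟩ := ih (fun g hg => hdeg g (Finset.mem_insert_of_mem hg))
      (fun g hg h hh => hF g (Finset.mem_insert_of_mem hg) h (Finset.mem_insert_of_mem hh))
    have hne : ∀ g ∈ F, f ≠ g := fun g hg h => hf (h ▸ hg)
    have hfF : ∀ g ∈ F, ∃ a ∈ D, ∃ c, f - g = C c * (X - C a) := fun g hg =>
      hF f (Finset.mem_insert_self f F) g (Finset.mem_insert_of_mem hg) (hne g hg)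
    have hf1 := hdeg f (Finset.mem_insert_self f F)
    obtain ⟨c, hc⟩ := prod_sub_dvd F hf hfF G hG
    have hBdeg : (∏ g ∈ F, (f - g)).natDegree = F.card := by
      rw [natDegree_prod _ _ fun g hg => sub_ne_zero.2 (hne g hg), Finset.card_eq_sum_ones]
      refine Finset.sum_congr rfl fun g hg => ?_
      obtain ⟨a, -, c, h⟩ := hfF g hg
      have hc0 : c ≠ 0 := by
        rintro rfl
        exact hne g hg (sub_eq_zero.1 (by rw [h]; simp))
      rw [h, natDegree_C_mul hc0, natDegree_X_sub_C]
    have hEdeg : (target D f - G.eval f).natDegree ≤ D.card - 1 :=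
      (natDegree_sub_le_of_le (natDegree_target_le hD hf1) (hGd.natDegree_eval_le hf1)).trans
        (max_self _).le
    refine ⟨G + C c * ∏ g ∈ F, (X - C g), hGd.add ?_, fun g hg => ?_⟩
    · by_cases h0 : c = 0
      · intro i j _; simp [h0]
      have hB0 : (∏ g ∈ F, (f - g)) ≠ 0 :=
        Finset.prod_ne_zero_iff.2 fun g hg => sub_ne_zero.2 (hne g hg)
      rw [hc, natDegree_mul hB0 h0, hBdeg] at hEdeg
      exact ((BivariateTotalDegreeLE.C_of_natDegree_le le_rfl).mul
        (BivariateTotalDegreeLE.prod_X_sub_C F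
          fun g hg => hdeg g (Finset.mem_insert_of_mem hg))).mono (by omega)
    · rw [eval_add, eval_mul, eval_C, eval_prod]
      simp only [eval_sub, eval_X, eval_C]
      rcases Finset.mem_insert.1 hg with rfl | hg
      · rw [mul_comm, ← hc]; ring
      · rw [Finset.prod_eq_zero hg (sub_self g), mul_zero, add_zero, hG g hg]

/-- In characteristic zero, a finite set of at least two directions cannot be the set of all
directions from one point of a finite set `F` of points of the affine plane if it contains all
directions determined by `F`. The points are given as the affine functions dual to them. -/
theorem exists_forall_eval_ne_zero [CharZero K] {D : Finset K} (hD : 2 ≤ D.card) (F : Finset K[X])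
    (h0 : 0 ∈ F) (hdeg : ∀ f ∈ F, f.natDegree ≤ 1)
    (hF : ∀ f ∈ F, ∀ g ∈ F, f ≠ g → ∃ a ∈ D, ∃ c, f - g = C c * (X - C a)) :
    ∃ a ∈ D, ∀ f ∈ F, f ≠ 0 → f.eval a ≠ 0 := by
  by_contra! hroot
  have hDne : D.Nonempty := Finset.card_pos.1 (by omega)
  obtain ⟨G, hGd, hG⟩ := exists_interpolation hDne F hdeg hF
  have hG0 : G.coeff 0 = 0 := by
    rw [coeff_zero_eq_eval_zero, hG 0 h0, target]; simp
  have hGX : G = G.divX * X := by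
    conv_lhs => rw [← divX_mul_X_add G, hG0, C_0, add_zero]
  have hval : ∀ a ∈ D, (G.coeff 1).eval a
      = ((D.card : K) - 1) * (derivative (∏ a ∈ D, (X - C a))).eval a := by
    intro a ha
    obtain ⟨f, hfF, hf0, hfa⟩ := hroot a ha
    obtain ⟨q, hq⟩ := dvd_iff_isRoot.2 hfa
    have hqdeg : q.natDegree = 0 := by
      have h1 := hdeg f hfF
      have hq0 : q ≠ 0 := by rintro rfl; simp [hq] at hf0
      rw [hq, natDegree_mul (X_sub_C_ne_zero a) hq0, natDegree_X_sub_C] at h1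
      omega
    obtain ⟨c, rfl⟩ : ∃ c, q = C c := ⟨_, eq_C_of_natDegree_eq_zero hqdeg⟩
    have hc0 : c ≠ 0 := by rintro rfl; simp [hq] at hf0
    obtain ⟨Q₁, hQ₁⟩ : (X - C a) ∣ ∏ a ∈ D, (X - C a) := Finset.dvd_prod_of_mem _ ha
    have h := hG f hfF
    rw [hGX, eval_mul, eval_X, target, hQ₁] at h
    have hder : derivative f = C c := by rw [hq]; simp
    have h' : (X - C a) * C c * G.divX.eval f = (X - C a) * C c *
        (C (D.card : K) * Q₁ - derivative ((X - C a) * Q₁)) := by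
      rw [← hq, mul_comm, h, hder, hq]; ring
    have h2 := mul_left_cancel₀
      (mul_ne_zero (X_sub_C_ne_zero a) (C_ne_zero.2 hc0)) h'
    have h3 := congrArg (eval a) h2
    have h4 : (G.divX.eval f).eval a = (G.coeff 1).eval a := by
      rw [← zero_add 1, ← coeff_divX, coeff_zero_eq_eval_zero, ← coe_evalRingHom a,
        ← eval₂_at_apply, ← eval₂_at_apply, coe_evalRingHom, hfa, eval_zero]
    rw [← h4, h3, hQ₁]
    simp
    ring
  -- Both sides have degree less than `d` and agree at the `d` points of `D`.
  have heq : G.coeff 1 = C ((D.card : K) - 1) * derivative (∏ a ∈ D, (X - C a)) := by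
    refine eq_of_degree_sub_lt_of_eval_finset_eq D ?_ fun a ha => by
      rw [hval a ha, eval_mul, eval_C]
    refine lt_of_le_of_lt degree_le_natDegree (Nat.cast_lt.2 (lt_of_le_of_lt
      (b := D.card - 1) ?_ (by omega)))
    refine (natDegree_sub_le_of_le (natDegree_le_iff_coeff_eq_zero.2 fun N hN =>
      hGd 1 N (by omega)) ((natDegree_C_mul_le _ _).trans
        (natDegree_derivative_prod_X_sub_C_le D))).trans (max_self _).le
  have hcoef := congrArg (fun q => coeff q (D.card - 1)) heq
  simp only [coeff_C_mul, coeff_derivative_prod_X_sub_C hDne] at hcoef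
  rw [hGd 1 (D.card - 1) (by omega)] at hcoef
  have hcard : (D.card : K) ≠ 0 := Nat.cast_ne_zero.2 (by omega)
  have hcard' : (D.card : K) - 1 ≠ 0 := sub_ne_zero.2 (by
    rw [← Nat.cast_one, Ne, Nat.cast_inj]; omega)
  exact mul_ne_zero hcard' hcard hcoef.symm

end AffineInterpolation

/-! ### Planes and complements in linear algebra. -/

namespace Submodule

variable {K V : Type*} [Field K] [AddCommGroup V] [Module K V]

theorem eq_of_finrank_eq_two_of_mem [FiniteDimensional K V] {M N : Submodule K V}
    (hM : Module.finrank K M = 2) (hN : Module.finrank K N = 2) {s t : V}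
    (hst : LinearIndependent K ![s, t]) (hsM : s ∈ M) (htM : t ∈ M) (hsN : s ∈ N) (htN : t ∈ N) :
    M = N := by
  have hspan : Module.finrank K (span K (Set.range ![s, t])) = 2 := by
    rw [finrank_span_eq_card hst, Fintype.card_fin]
  have hle : ∀ {P : Submodule K V}, s ∈ P → t ∈ P → span K (Set.range ![s, t]) ≤ P := by
    intro P hs ht
    rw [span_le]
    rintro _ ⟨i, rfl⟩
    fin_cases i
    · exact hs
    · exact ht
  rw [← eq_of_le_of_finrank_eq (hle hsM htM) (hspan.trans hM.symm),
    ← eq_of_le_of_finrank_eq (hle hsN htN) (hspan.trans hN.symm)]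

theorem eq_zero_of_smul_mem {N : Submodule K V} {v : V} (hv : v ∉ N) {c : K} (h : c • v ∈ N) :
    c = 0 := by
  by_contra hc
  exact hv ((smul_mem_iff N hc).1 h)

variable [FiniteDimensional K V] {N : Submodule K V}

theorem sup_eq_top_of_notMem (h : Module.finrank K V = Module.finrank K N + 1)
    {P : Submodule K V} {v : V} (hvP : v ∈ P) (hv : v ∉ N) : N ⊔ P = ⊤ := by
  refine eq_top_of_finrank_eq (le_antisymm (finrank_le _) ?_)
  have hlt : N < N ⊔ P := lt_of_le_of_ne le_sup_left fun h => hv (h ▸ mem_sup_right hvP)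
  have := finrank_lt_finrank_of_lt hlt
  omega

theorem exists_add_smul_mem (h : Module.finrank K V = Module.finrank K N + 1) {v : V}
    (hv : v ∉ N) (w : V) : ∃ c : K, w + c • v ∈ N := by
  have hw : w ∈ N ⊔ span K {v} := by
    rw [sup_eq_top_of_notMem h (mem_span_singleton_self v) hv]; exact mem_top
  obtain ⟨n, hn, _, hy, rfl⟩ := mem_sup.1 hw
  obtain ⟨c, rfl⟩ := mem_span_singleton.1 hy
  exact ⟨-c, by simpa using hn⟩

end Submodule

/-! ### From arrangements to affine functions. -/

namespace LineArrangement

variable {K : Type*} [Field K] (A : LineArrangement K)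

theorem finrank_eq_add_one {N : Submodule K (Fin 3 → K)} (hN : N ∈ A.lines) :
    Module.finrank K (Fin 3 → K) = Module.finrank K N + 1 := by
  rw [A.finrank_eq_two N hN, Module.finrank_fin_fun]

theorem inf_mem_points {H L : Submodule K (Fin 3 → K)} (hH : H ∈ A.lines) (hL : L ∈ A.lines)
    {v : Fin 3 → K} (hvL : v ∈ L) (hvH : v ∉ H) : H ⊓ L ∈ A.points := by
  refine ⟨⟨{H, L}, ?_, sInf_pair.symm⟩, ?_⟩
  · rintro N (rfl | rfl)
    · exact hH
    · exact hL
  · have h := Submodule.finrank_sup_add_finrank_inf_eq H L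
    rw [Submodule.sup_eq_top_of_notMem (A.finrank_eq_add_one hH) hvL hvH, finrank_top,
      Module.finrank_fin_fun, A.finrank_eq_two H hH, A.finrank_eq_two L hL] at h
    omega

/-- If `H` carries no double points, then every intersection of `H` with a line `L` of the
arrangement lies on a third line. -/
theorem exists_third_line_of_n2_eq_zero {H L : Submodule K (Fin 3 → K)} (hH : H ∈ A.lines)
    (hL : L ∈ A.lines) (hn : A.n2 H = 0) {v : Fin 3 → K} (hvL : v ∈ L) (hvH : v ∉ H) :
    ∃ N ∈ A.lines, N ≠ H ∧ N ≠ L ∧ H ⊓ L ≤ N := by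
  by_contra! hno
  have hempty := (Set.ncard_eq_zero (A.finite_doublePointsOn H)).1 hn
  have hlines : A.linesThrough (H ⊓ L) = {H, L} := by
    ext N
    constructor
    · rintro ⟨hN, hle⟩
      by_contra hNHL
      rw [Set.mem_insert_iff, Set.mem_singleton_iff, not_or] at hNHL
      exact hno N hN hNHL.1 hNHL.2 hle
    · rintro (rfl | rfl)
      · exact ⟨hH, inf_le_left⟩
      · exact ⟨hL, inf_le_right⟩
  have hne : H ≠ L := fun h => hvH (h ▸ hvL)
  have hmem : H ⊓ L ∈ A.doublePointsOn H := by
    refine ⟨A.inf_mem_points hH hL hvL hvH, ?_, inf_le_left⟩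
    rw [mu, hlines, Set.ncard_pair hne]
    norm_num
  rw [hempty] at hmem
  exact hmem

/-- A line not through `v` contains a vector that lies on none of the lines of the arrangement
through `v`. -/
theorem exists_mem_forall_notMem [Infinite K] {H : Submodule K (Fin 3 → K)} (hH : H ∈ A.lines)
    {v : Fin 3 → K} (hv : v ∉ H) : ∃ w ∈ H, ∀ L ∈ A.lines, v ∈ L → w ∉ L := by
  classical
  set T := (A.finite_lines.subset (Set.sep_subset A.lines fun L => v ∈ L)).toFinset with hT
  have htop : ⊤ ∉ T.image (Submodule.comap H.subtype) := by
    intro h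
    obtain ⟨L, hL, hLtop⟩ := Finset.mem_image.1 h
    rw [hT, Set.Finite.mem_toFinset] at hL
    have hle : H ≤ L := by rwa [Submodule.comap_subtype_eq_top] at hLtop
    have := Submodule.eq_of_le_of_finrank_eq hle
      ((A.finrank_eq_two H hH).trans (A.finrank_eq_two L hL.1).symm)
    exact hv (this ▸ hL.2)
  obtain ⟨w, hw⟩ := (Set.ne_univ_iff_exists_notMem _).1
    (Subspace.biUnion_ne_univ_of_top_notMem htop)
  refine ⟨w, w.2, fun L hL hvL hwL => hw ?_⟩
  simp only [Set.mem_iUnion]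
  exact ⟨_, Finset.mem_image_of_mem _ ((Set.Finite.mem_toFinset _).2 ⟨hL, hvL⟩), hwL⟩

open Polynomial in
/-- A line `H` not through a modular point `p` with at least two lines through it contains a double
point. -/
theorem n2_ne_zero_of_isModularPoint [CharZero K] {p : Submodule K (Fin 3 → K)}
    (hp : A.IsModularPoint p) (hmu : 1 ≤ A.mu p) {H : Submodule K (Fin 3 → K)}
    (hHp : H ∈ A.lines \ A.linesThrough p) : A.n2 H ≠ 0 := by
  classical
  intro hn
  obtain ⟨⟨-, hp1⟩, hmod⟩ := hp
  have hH := hHp.1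
  obtain ⟨v, hv⟩ : ∃ v, p = Submodule.span K {v} := by
    obtain ⟨⟨v, hvp⟩, -, h⟩ := finrank_eq_one_iff'.1 hp1
    refine ⟨v, le_antisymm (fun x hx => ?_) ((Submodule.span_singleton_le_iff_mem _ _).2 hvp)⟩
    obtain ⟨c, hc⟩ := h ⟨x, hx⟩
    exact Submodule.mem_span_singleton.2 ⟨c, congrArg Subtype.val hc⟩
  have hthrough : ∀ N, N ∈ A.linesThrough p ↔ N ∈ A.lines ∧ v ∈ N := fun N => by
    rw [linesThrough, Set.mem_ofPred_eq, hv, Submodule.span_singleton_le_iff_mem]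
  have hoff : ∀ N, N ∈ A.lines \ A.linesThrough p ↔ N ∈ A.lines ∧ v ∉ N := fun N => by
    rw [Set.mem_sdiff, hthrough]; tauto
  have hvH : v ∉ H := ((hoff H).1 hHp).2
  -- `w` is the point at infinity of `H`: no line through `p` contains it, so each meets `H` at a
  -- finite point `u + a • w`.
  obtain ⟨w, hwH, hw⟩ := A.exists_mem_forall_notMem hH hvH
  obtain ⟨u, huH, huw⟩ : ∃ u ∈ H, u ∉ Submodule.span K {w} := by
    by_contra! h
    have h1 := Submodule.finrank_mono (show H ≤ Submodule.span K {w} from h)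
    have h2 := finrank_span_le_card (R := K) ({w} : Set (Fin 3 → K))
    rw [Set.toFinset_singleton, Finset.card_singleton] at h2
    rw [A.finrank_eq_two H hH] at h1
    omega
  have huw' : ∀ c d : K, c • w + d • u = 0 → c = 0 ∧ d = 0 := by
    intro c d h
    have hd : d = 0 := Submodule.eq_zero_of_smul_mem huw (Submodule.mem_span_singleton.2
      ⟨-c, by rw [neg_smul]; exact (eq_neg_of_add_eq_zero_right h).symm⟩)
    subst hd
    have hw0 : w ∉ (⊥ : Submodule K (Fin 3 → K)) := by
      obtain ⟨L, hL⟩ := Set.nonempty_of_ncard_ne_zero (s := A.linesThrough p) (by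
        rw [mu] at hmu; omega)
      exact fun h => hw L hL.1 ((hthrough L).1 hL).2 (bot_le (a := L) h)
    refine ⟨Submodule.eq_zero_of_smul_mem hw0 ?_, rfl⟩
    simpa using h
  have hindep : ∀ t : K, LinearIndependent K ![u + t • w, v] := by
    refine fun t => LinearIndependent.pair_iff.2 fun c d h => ?_
    have hcH : c • (u + t • w) ∈ H :=
      H.smul_mem c (H.add_mem huH (H.smul_mem _ hwH))
    have hd : d = 0 := Submodule.eq_zero_of_smul_mem hvH
      ((Submodule.add_mem_iff_right H hcH).1 (h ▸ H.zero_mem))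
    refine ⟨(huw' (c * t) c ?_).2, hd⟩
    rw [← h, hd]; module
  have ha : ∀ L, ∃ a : K, L ∈ A.linesThrough p → u + a • w ∈ L := by
    intro L
    by_cases hL : L ∈ A.linesThrough p
    · obtain ⟨a, ha⟩ := Submodule.exists_add_smul_mem (A.finrank_eq_add_one hL.1)
        (hw L hL.1 ((hthrough L).1 hL).2) u
      exact ⟨a, fun _ => ha⟩
    · exact ⟨0, fun h => (hL h).elim⟩
  choose a ha using ha
  have haff : ∀ N, ∃ α β : K, N ∈ A.lines \ A.linesThrough p →
      w + α • v ∈ N ∧ u + β • v ∈ N := by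
    intro N
    by_cases hN : N ∈ A.lines \ A.linesThrough p
    · have hvN := ((hoff N).1 hN).2
      obtain ⟨α, hα⟩ := Submodule.exists_add_smul_mem (A.finrank_eq_add_one hN.1) hvN w
      obtain ⟨β, hβ⟩ := Submodule.exists_add_smul_mem (A.finrank_eq_add_one hN.1) hvN u
      exact ⟨α, β, fun _ => ⟨hα, hβ⟩⟩
    · exact ⟨0, 0, fun h => (hN h).elim⟩
  choose α β haff using haff
  have hinj : ∀ N ∈ A.lines \ A.linesThrough p, ∀ N' ∈ A.lines \ A.linesThrough p,
      α N = α N' → β N = β N' → N = N' := by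
    intro N hN N' hN' h1 h2
    have hN1 := haff N' hN'
    rw [← h1, ← h2] at hN1
    refine Submodule.eq_of_finrank_eq_two_of_mem (A.finrank_eq_two N hN.1)
      (A.finrank_eq_two N' hN'.1) (LinearIndependent.pair_iff.2 fun c d h => ?_)
      (haff N hN).1 (haff N hN).2 hN1.1 hN1.2
    have h' : c • w + d • u + (c * α N + d * β N) • v = 0 := by
      rw [← h]; module
    have hcd : c • w + d • u ∈ H := H.add_mem (H.smul_mem c hwH) (H.smul_mem d huH)
    have h0 : c * α N + d * β N = 0 := Submodule.eq_zero_of_smul_mem hvH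
      ((Submodule.add_mem_iff_right H hcd).1 (h' ▸ H.zero_mem))
    rw [h0, zero_smul, add_zero] at h'
    exact huw' c d h'
  have hHzero : α H = 0 ∧ β H = 0 := by
    obtain ⟨h1, h2⟩ := haff H hHp
    exact ⟨Submodule.eq_zero_of_smul_mem hvH ((Submodule.add_mem_iff_right H hwH).1 h1),
      Submodule.eq_zero_of_smul_mem hvH ((Submodule.add_mem_iff_right H huH).1 h2)⟩
  have hainj : Set.InjOn a (A.linesThrough p) := by
    intro L hL L' hL' h
    have hL1 := ha L' hL'
    rw [← h] at hL1
    exact Submodule.eq_of_finrank_eq_two_of_mem (A.finrank_eq_two L hL.1)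
      (A.finrank_eq_two L' hL'.1) (hindep (a L))
      (ha L hL) ((hthrough L).1 hL).2 hL1 ((hthrough L').1 hL').2
  have hfin : (A.linesThrough p).Finite := A.finite_lines.subset fun N hN => hN.1
  have hfin' : (A.lines \ A.linesThrough p).Finite := A.finite_lines.subset fun N hN => hN.1
  have hDcard : 2 ≤ (hfin.toFinset.image a).card := by
    rw [Finset.card_image_of_injOn (by simpa using hainj), ← Set.ncard_eq_toFinset_card _ hfin]
    rw [mu] at hmu
    omega
  obtain ⟨_, haL, hno⟩ := AffineInterpolation.exists_forall_eval_ne_zero hDcard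
    (hfin'.toFinset.image fun N => C (α N) * X + C (β N))
    (Finset.mem_image.2 ⟨H, hfin'.mem_toFinset.2 hHp, by simp [hHzero]⟩)
    (by
      intro f hf
      obtain ⟨N, -, rfl⟩ := Finset.mem_image.1 hf
      exact natDegree_linear_le)
    (by
      intro f hf g hg hfg
      obtain ⟨N, hN, rfl⟩ := Finset.mem_image.1 hf
      obtain ⟨N', hN', rfl⟩ := Finset.mem_image.1 hg
      rw [hfin'.mem_toFinset] at hN hN'
      obtain ⟨L, ⟨hL, hle⟩, -⟩ := hmod N hN N' hN' (by rintro rfl; exact hfg rfl)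
      refine ⟨a L, Finset.mem_image_of_mem a (hfin.mem_toFinset.2 hL), α N - α N', ?_⟩
      obtain ⟨h1, h2⟩ := haff N hN
      obtain ⟨h1', h2'⟩ := haff N' hN'
      -- This combination is symmetric under exchanging `N` and `N'` up to sign, hence lies in both;
      -- comparing it with `u + a L • w` and `v` in `L` places the common value of the two functions
      -- at `a L`.
      have hs : (β N' - β N) • (w + α N • v) + (α N - α N') • (u + β N • v) ∈ L := by
        refine hle ⟨N.add_mem (N.smul_mem _ h1) (N.smul_mem _ h2), ?_⟩
        have := N'.add_mem (N'.smul_mem (β N' - β N) h1') (N'.smul_mem (α N - α N') h2')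
        rw [SetLike.mem_coe]
        convert this using 1
        module
      have hvL := ((hthrough L).1 hL).2
      have hwL : (β N' - β N - a L * (α N - α N')) • w ∈ L := by
        have := L.sub_mem (L.sub_mem hs (L.smul_mem (α N - α N') (ha L hL)))
          (L.smul_mem ((β N' - β N) * α N + (α N - α N') * β N) hvL)
        convert this using 1
        module
      have h0 := Submodule.eq_zero_of_smul_mem (hw L hL.1 hvL) hwL
      have hβ : β N' = β N + a L * (α N - α N') := by linear_combination h0
      rw [hβ]
      simp only [C_add, C_mul, C_sub]
      ring)
  obtain ⟨L, hL, rfl⟩ := Finset.mem_image.1 haL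
  rw [hfin.mem_toFinset] at hL
  have hvL := ((hthrough L).1 hL).2
  -- The third line through `H ⊓ L` cannot contain `p`, so it gives a nonzero function vanishing at
  -- `a L`.
  obtain ⟨N, hN, hNH, hNL, hle⟩ := A.exists_third_line_of_n2_eq_zero hH hL.1 hn hvL hvH
  have hq : u + a L • w ∈ N := hle ⟨H.add_mem huH (H.smul_mem _ hwH), ha L hL⟩
  have hvN : v ∉ N := by
    intro hvN
    exact hNL (Submodule.eq_of_finrank_eq_two_of_mem (A.finrank_eq_two N hN)
      (A.finrank_eq_two L hL.1) (hindep (a L))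
      hq hvN (ha L hL) hvL)
  have hNp := (hoff N).2 ⟨hN, hvN⟩
  obtain ⟨h1, h2⟩ := haff N hNp
  refine hno _ (Finset.mem_image_of_mem _ (hfin'.mem_toFinset.2 hNp)) (fun h0 => hNH ?_) ?_
  · have hα := congrArg (fun f => coeff f 1) h0
    have hβ := congrArg (fun f => coeff f 0) h0
    simp at hα hβ
    exact hinj N hNp H hHp (hα.trans hHzero.1.symm) (hβ.trans hHzero.2.symm)
  · refine Submodule.eq_zero_of_smul_mem hvN ?_
    have := N.sub_mem (N.add_mem h2 (N.smul_mem (a L) h1)) hq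
    convert this using 1
    simp only [eval_add, eval_mul, eval_C, eval_X]
    module

end LineArrangement

theorem theorem3p5 {K : Type*} [Field K] [CharZero K] :
    ¬ ∃ A : LineArrangement K, A.IsSupersolvable ∧
      ∃ p : Submodule K (Fin 3 → K), A.IsModularPoint p ∧ 2 ≤ A.mu p ∧
        ∃ H ∈ A.lines \ A.linesThrough p, A.n2 H = 0 := by
  rintro ⟨A, -, p, hp, hmu, H, hH, hn⟩
  exact A.n2_ne_zero_of_isModularPoint hp (by omega) hH hn
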